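/- Setting. A set $\mathcal X\subseteq\mathbb R^d$ is called cubifiable if $\mathcal X=\times_{i=1}^d\mathcal X_i$ for measurable sets $\mathcal X_i\subseteq\mathbb R$ such that for each $i$ there is a strictly increasing $C^1$-diffeomorphism $\psi_i:\mathcal X_i\to(0,1)$, meaning a strictly increasing bijection whose inverse is continuously differentiable. $\mathcal D(\mathcal X)$ is the set of all maps $\psi:\mathcal X\to(0,1)^d$, $\psi(x)=(\psi_1(x_1),\dots,\psi_d(x_d))$, arising in this way. $\mathcal P_b(\mathcal X)$ is the set of probability measures on $\mathcal X$ with a continuous and bounded density with respect to Lebesgue measure, and $\widetilde{\mathcal P}_b(\mathcal X)$ is the set of those $\pi\in\mathcal P_b(\mathcal X)$ whose push-forward by some $\psi\in\mathcal D(\mathcal X)$ belongs to $\mathcal P_b((0,1)^d)$. For $N\ge1$ let $\mathcal Z^N$ be the set of $z=(x^n,w^n)_{n=1}^N$ with $x^n\in\mathcal X$, $w^n\ge0$ and $\sum_{n=1}^Nw^n=1$. Let $U=(U_1,U_2,\dots)$ be i.i.d. uniform random variables on $[0,1]$, defined on a probability space $(\Omega,\mathcal F,\mathbb P)$. Stratified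 resampling $\rho_{\mathrm{strat}}$ maps $u\in[0,1]^{\mathbb N}$ and $z\in\mathcal Z^N$ to $$\rho_{\mathrm{strat}}(u,z)=\frac1N\sum_{n=1}^N\delta\big(x^{a^n(u,z)}\big),\qquad a^n(u,z)=\min\Big\{m\in\{1,\dots,N\}:\ \sum_{k=1}^m w^k\ge\frac{n-1+u_n}{N}\Big\}.$$ Put $\#^n(u,z)=\mathrm{card}\{i:\ a^i(u,z)=n\}$ and $\Delta^n_z=\#^n(U,z)-Nw^n$. Statement. Let $\mathcal X$ be a cubifiable set. Then: (H1) For every $N\ge1$ and $z\in\mathcal Z^N$ the random variables $(\#^n(U,z))_{n=1}^N$ are negatively associated: for all disjoint $I_1,I_2\subseteq\{1,\dots,N\}$ and all coordinatewise non-decreasing $\varphi_k:\mathbb R^{I_k}\to\mathbb R$, $k=1,2$, the covariance of $\varphi_1(\#^n(U,z),n\in I_1)$ and $\varphi_2(\#^n(U,z),n\in I_2)$ is at most $0$ whenever it is well defined. (H2) There is a sequence $(r_N)_{N\ge1}$ of non-negative real numbers with $r_N=o(N/\log N)$ such that, for $N$ large enough, $$\sup_{z\in\mathcal Z^N}\sum_{n=1}^N\mathbb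 E\big[(\Delta^n_z)^2\big]\le r_N\,N,\qquad\text{and}\qquad\sum_{N=1}^\infty\ \sup_{z\in\mathcal Z^N}\mathbb P\Big(\max_{1\le n\le N}|\Delta^n_z|>r_N\Big)<\infty.$$ Moreover, for every $N\ge1$ and $z\in\mathcal Z^N$, $\mathbb P$-almost surely $|\Delta^n_z|\le2$ for all $n\in\{1,\dots,N\}$. (Consistency) $\rho_{\mathrm{strat}}$ is $\widetilde{\mathcal P}_b(\mathcal X)$-consistent: for every $\pi\in\widetilde{\mathcal P}_b(\mathcal X)$ and every sequence $(\zeta^N)_{N\ge1}$ of random elements $\zeta^N=(X^{n,N},W^{n,N})_{n=1}^N$ of $\mathcal Z^N$ on $(\Omega,\mathcal F,\mathbb P)$ that is independent of $U$, if $\sum_{n=1}^NW^{n,N}\delta(X^{n,N})$ converges weakly to $\pi$ $\mathbb P$-almost surely, then $\rho_{\mathrm{strat}}(U,\zeta^N)$ converges weakly to $\pi$ $\mathbb P$-almost surely. -/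

import Mathlib

open MeasureTheory ProbabilityTheory Filter Asymptotics
open scoped Topology ENNReal unitInterval BoundedContinuousFunction

noncomputable section

namespace Resampling

/-! ### Cubifiable sets and classes of probability measures -/

/-- The open unit cube `(0,1)^d`. -/
def cube (d : ℕ) : Set (Fin d → ℝ) := Set.univ.pi fun _ => Set.Ioo 0 1

/-- `f` restricts to a strictly increasing bijection from `A ⊆ ℝ` onto `(0,1)` whose inverse is
continuously differentiable on `(0,1)`.  (Only the inverse is required to be `C¹`; maps that are
`C¹` in both directions are included.) -/
structure IsIncreasingDiffeo (A : Set ℝ) (f : ℝ → ℝ) : Prop where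
  bijOn : Set.BijOn f A (Set.Ioo 0 1)
  strictMonoOn : StrictMonoOn f A
  inverse_contDiffOn : ∃ g : ℝ → ℝ, Set.LeftInvOn g f A ∧ ContDiffOn ℝ 1 g (Set.Ioo 0 1)

/-- `X` is a product of measurable sets `Xᵢ ⊆ ℝ`, each of which is mapped onto `(0,1)` by a strictly
increasing `C¹`-diffeomorphism. -/
def Cubifiable {d : ℕ} (X : Set (Fin d → ℝ)) : Prop :=
  ∃ A : Fin d → Set ℝ, (∀ i, MeasurableSet (A i)) ∧ X = Set.univ.pi A ∧
    ∀ i, ∃ f : ℝ → ℝ, IsIncreasingDiffeo (A i) f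

/-- The class `𝒟(X)` of maps `ψ : X → (0,1)^d`, `ψ(x) = (ψ₁(x₁), …, ψ_d(x_d))`, that witness that
`X` is cubifiable. -/
def diffeos {d : ℕ} (X : Set (Fin d → ℝ)) : Set (X → cube d) :=
  {ψ | ∃ A : Fin d → Set ℝ, (∀ i, MeasurableSet (A i)) ∧ X = Set.univ.pi A ∧
    ∃ f : Fin d → ℝ → ℝ, (∀ i, IsIncreasingDiffeo (A i) (f i)) ∧
      ∀ (x : X) (i : Fin d), (ψ x : Fin d → ℝ) i = f i ((x : Fin d → ℝ) i)}

/-- `μ` has a continuous and bounded density with respect to Lebesgue measure on `S ⊆ ℝ^d`. -/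
def HasBddContDensity {d : ℕ} {S : Set (Fin d → ℝ)} (μ : Measure S) : Prop :=
  ∃ p : S →ᵇ ℝ, (∀ x, 0 ≤ p x) ∧
    μ = (Measure.comap ((↑) : S → (Fin d → ℝ)) volume).withDensity fun x => ENNReal.ofReal (p x)

/-- The class `𝒫̃_b(X)`: probability measures with a continuous and bounded density whose
push-forward by some `ψ ∈ 𝒟(X)` also has a continuous and bounded density on `(0,1)^d`. -/
def PbTilde {d : ℕ} (X : Set (Fin d → ℝ)) : Set (ProbabilityMeasure X) :=
  {π | HasBddContDensity (π : Measure X) ∧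
    ∃ ψ ∈ diffeos X, HasBddContDensity ((π : Measure X).map ψ)}

/-! ### Weighted point sets and resampling schemes -/

/-- The set `𝒵^N` of weighted samples `(xⁿ, wⁿ)`, `n = 1, …, N`, with non-negative weights that sum
to one.  It is empty for `N = 0`. -/
abbrev WeightedSample {d : ℕ} (X : Set (Fin d → ℝ)) (N : ℕ) : Type :=
  {z : (Fin N → X) × (Fin N → ℝ) // (∀ n, 0 ≤ z.2 n) ∧ ∑ n, z.2 n = 1}

variable {d : ℕ} {X : Set (Fin d → ℝ)} {N : ℕ}

/-- The `n`-th point of a weighted sample. -/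
def WeightedSample.point (z : WeightedSample X N) (n : Fin N) : X := z.1.1 n

/-- The `n`-th weight of a weighted sample. -/
def WeightedSample.weight (z : WeightedSample X N) (n : Fin N) : ℝ := z.1.2 n

theorem WeightedSample.size_ne_zero (z : WeightedSample X N) : N ≠ 0 := by
  rintro rfl
  simpa using z.2.2

/-- The weighted empirical measure `∑ₙ wⁿ δ(xⁿ)`. -/
def WeightedSample.measure (z : WeightedSample X N) : ProbabilityMeasure X :=
  ⟨∑ n, ENNReal.ofReal (z.weight n) • Measure.dirac (z.point n), ⟨by
    have h := ENNReal.ofReal_sum_of_nonneg (s := Finset.univ) (f := z.weight) fun n _ => z.2.1 n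
    have h1 : ∑ n, z.weight n = 1 := z.2.2
    simp [← h, h1]⟩⟩

/-- A resampling scheme on `X`: for each `N`, measurable functions
`aⁿ_N : [0,1]^ℕ × 𝒵^N → {1, …, N}` selecting the indices of the resampled points. -/
structure Scheme {d : ℕ} (X : Set (Fin d → ℝ)) where
  index : (N : ℕ) → (ℕ → I) → WeightedSample X N → Fin N → Fin N
  measurable_index : ∀ (N : ℕ) (n : Fin N),
    Measurable fun p : (ℕ → I) × WeightedSample X N => index N p.1 p.2 n

/-- The resampled measure `ρ(u, z) = N⁻¹ ∑ₙ δ(x^{aⁿ(u,z)})`. -/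
def Scheme.resample (ρ : Scheme X) (u : ℕ → I) (z : WeightedSample X N) : ProbabilityMeasure X :=
  ⟨(N : ℝ≥0∞)⁻¹ • ∑ n, Measure.dirac (z.point (ρ.index N u z n)), ⟨by
    simpa using ENNReal.inv_mul_cancel (by simpa using z.size_ne_zero) (ENNReal.natCast_ne_top N)⟩⟩

/-- The number of offspring `#ⁿ(u, z)` of the `n`-th point. -/
def Scheme.offspring (ρ : Scheme X) (u : ℕ → I) (z : WeightedSample X N) (n : Fin N) : ℕ :=
  (Finset.univ.filter fun i => ρ.index N u z i = n).card

/-- The deviation `Δⁿ = #ⁿ(u, z) - N wⁿ`. -/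
def Scheme.deviation (ρ : Scheme X) (u : ℕ → I) (z : WeightedSample X N) (n : Fin N) : ℝ :=
  (ρ.offspring u z n : ℝ) - N * z.weight n

/-! ### Negative association, the two conditions, and consistency -/

/-- Negative association of a family of real random variables.  The three integrability
requirements say that the covariance is well defined. -/
def NegativelyAssociated {Ω ι : Type*} [MeasurableSpace Ω] (P : Measure Ω) (Z : ι → Ω → ℝ) : Prop :=
  ∀ I₁ I₂ : Finset ι, Disjoint I₁ I₂ →
    ∀ (φ₁ : (I₁ → ℝ) → ℝ) (φ₂ : (I₂ → ℝ) → ℝ), Monotone φ₁ → Monotone φ₂ →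
      Integrable (fun ω => φ₁ fun i => Z i ω) P →
      Integrable (fun ω => φ₂ fun i => Z i ω) P →
      Integrable (fun ω => (φ₁ fun i => Z i ω) * (φ₂ fun i => Z i ω)) P →
      cov[fun ω => φ₁ fun i => Z i ω, fun ω => φ₂ fun i => Z i ω; P] ≤ 0

section Conditions

variable {Ω : Type*} [MeasurableSpace Ω]

/-- The offspring numbers are negatively associated, for every weighted sample. -/
def Scheme.H1 (ρ : Scheme X) (P : Measure Ω) (U : Ω → ℕ → I) : Prop :=
  ∀ (N : ℕ) (z : WeightedSample X N),
    NegativelyAssociated P fun (n : Fin N) ω => (ρ.offspring (U ω) z n : ℝ)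

/-- Second moment bound and negligibility of the deviations, uniformly over weighted samples.  The
suprema are taken in `[0, ∞]`; the term `N = 0` of the series is a supremum over the empty set,
that is, `0`. -/
def Scheme.H2 (ρ : Scheme X) (P : Measure Ω) (U : Ω → ℕ → I) : Prop :=
  ∃ r : ℕ → ℝ, (∀ N, 0 ≤ r N) ∧
    r =o[atTop] (fun N : ℕ => (N : ℝ) / Real.log N) ∧
    (∀ᶠ N : ℕ in atTop,
      (⨆ z : WeightedSample X N, ∑ n, ∫⁻ ω, ENNReal.ofReal (ρ.deviation (U ω) z n ^ 2) ∂P)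
        ≤ ENNReal.ofReal (r N * N)) ∧
    (∑' N : ℕ, ⨆ z : WeightedSample X N, P {ω | ∃ n, r N < |ρ.deviation (U ω) z n|}) < ∞

/-- `𝒫₀`-consistency: for every `π ∈ 𝒫₀` and every sequence of random weighted samples,
independent of `U`, whose weighted empirical measures converge weakly to `π` almost surely, the
resampled measures converge weakly to `π` almost surely.  The topology of `ProbabilityMeasure X`
is that of weak convergence. -/
def Scheme.Consistent (ρ : Scheme X) (P : Measure Ω) (U : Ω → ℕ → I)
    (P₀ : Set (ProbabilityMeasure X)) : Prop :=
  ∀ π ∈ P₀, ∀ ζ : (N : ℕ+) → Ω → WeightedSample X N,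
    (∀ N, Measurable (ζ N)) →
    IndepFun U (fun ω N => ζ N ω) P →
    (∀ᵐ ω ∂P, Tendsto (fun N : ℕ+ => (ζ N ω).measure) atTop (𝓝 π)) →
    ∀ᵐ ω ∂P, Tendsto (fun N : ℕ+ => ρ.resample (U ω) (ζ N ω)) atTop (𝓝 π)

end Conditions

/-! ### Stratified resampling -/

/-- The distribution function `F_N(n) = ∑_{m ≤ n} w^m` on indices. -/
def WeightedSample.cdf (z : WeightedSample X N) (n : Fin N) : ℝ :=
  ∑ m ∈ Finset.univ.filter (fun m => m ≤ n), z.weight m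

theorem WeightedSample.exists_le_cdf (z : WeightedSample X N) {v : ℝ} (hv : v ≤ 1) :
    (Finset.univ.filter fun n => v ≤ z.cdf n).Nonempty := by
  have hN : 0 < N := Nat.pos_of_ne_zero z.size_ne_zero
  refine ⟨⟨N - 1, by omega⟩, ?_⟩
  have h1 : (Finset.univ.filter fun m : Fin N => m ≤ ⟨N - 1, by omega⟩) = Finset.univ := by
    ext m
    simp only [Finset.mem_filter, Finset.mem_univ, true_and, iff_true, Fin.le_def]
    omega
  have h2 : ∑ n, z.weight n = 1 := z.2.2
  rw [Finset.mem_filter]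
  refine ⟨Finset.mem_univ _, ?_⟩
  rw [WeightedSample.cdf, h1, h2]
  exact hv

/-- The generalized inverse `F_N⁻(v) = min {n : F_N(n) ≥ v}`, for `v ≤ 1`. -/
def WeightedSample.quantile (z : WeightedSample X N) (v : ℝ) (hv : v ≤ 1) : Fin N :=
  (Finset.univ.filter fun n => v ≤ z.cdf n).min' (z.exists_le_cdf hv)

theorem WeightedSample.quantile_eq_iff (z : WeightedSample X N) (v : ℝ) (hv : v ≤ 1) (n : Fin N) :
    z.quantile v hv = n ↔ v ≤ z.cdf n ∧ ∀ m, m < n → z.cdf m < v := by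
  unfold WeightedSample.quantile
  rw [Finset.min'_eq_iff]
  simp only [Finset.mem_filter, Finset.mem_univ, true_and]
  refine and_congr_right fun _ => forall_congr' fun m => ?_
  rw [← not_lt, ← not_lt]
  exact not_imp_not

/-- The `n`-th stratified point.  Indices start at `0`, so that this is `(n - 1 + uₙ) / N` in
one-based indexing. -/
def stratPoint (u : ℕ → I) (n : Fin N) : ℝ := ((n : ℝ) + (u n : ℝ)) / N

theorem stratPoint_le_one (u : ℕ → I) (n : Fin N) : stratPoint u n ≤ 1 := by
  have hn : ((n : ℕ) : ℝ) + 1 ≤ N := by exact_mod_cast n.2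
  have hu : (u n : ℝ) ≤ 1 := (u n).2.2
  exact div_le_one_of_le₀ (by linarith) (Nat.cast_nonneg N)

/-- Stratified resampling: `aⁿ_N(u, z) = F_N⁻((n - 1 + uₙ) / N)`. -/
def stratified (X : Set (Fin d → ℝ)) : Scheme X where
  index N u z n := z.quantile (stratPoint u n) (stratPoint_le_one u n)
  measurable_index N n := by
    refine measurable_to_countable' fun m => ?_
    have hcdf : ∀ m : Fin N,
        Measurable fun p : (ℕ → I) × WeightedSample X N => p.2.cdf m := fun m => by
      unfold WeightedSample.cdf WeightedSample.weight
      fun_prop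
    have hpt : Measurable fun p : (ℕ → I) × WeightedSample X N => stratPoint p.1 n := by
      unfold stratPoint
      fun_prop
    have : (fun p : (ℕ → I) × WeightedSample X N =>
        p.2.quantile (stratPoint p.1 n) (stratPoint_le_one p.1 n)) ⁻¹' {m} =
        {p | stratPoint p.1 n ≤ p.2.cdf m} ∩
          ⋂ k : Fin N, ⋂ _ : k < m, {p | p.2.cdf k < stratPoint p.1 n} := by
      ext p
      simp [WeightedSample.quantile_eq_iff]
    rw [this]
    exact (measurableSet_le hpt (hcdf m)).inter
      (MeasurableSet.iInter fun k => MeasurableSet.iInter fun _ => measurableSet_lt (hcdf k) hpt)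

end Resampling

end

namespace Resampling

section OccupationNumbers

variable {ι : Type*}

/-- The number of occurrences of `j` among the values of `a`. -/
def occupation [DecidableEq ι] {M : ℕ} (a : Fin M → ι) (j : ι) : ℕ :=
  (Finset.univ.filter fun i => a i = j).card

theorem occupation_cons [DecidableEq ι] {M : ℕ} (j : ι) (a : Fin M → ι) :
    occupation (Fin.cons j a : Fin (M + 1) → ι) = occupation a + Pi.single j 1 := by
  ext k
  simp only [occupation, Pi.add_apply, Finset.card_filter, Fin.sum_univ_succ, Fin.cons_zero,
    Fin.cons_succ, Pi.single_apply]
  rw [add_comm]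
  congr 1
  simp only [eq_comm]

variable [Fintype ι]

/-- The expectation of `f` under the product of the distributions `p i`. -/
def prodExpect {M : ℕ} (p : Fin M → ι → ℝ) (f : (Fin M → ι) → ℝ) : ℝ :=
  ∑ a, (∏ i, p i (a i)) * f a

theorem prodExpect_succ {M : ℕ} (p : Fin (M + 1) → ι → ℝ) (f : (Fin (M + 1) → ι) → ℝ) :
    prodExpect p f = ∑ j, p 0 j * prodExpect (Fin.tail p) fun a => f (Fin.cons j a) := by
  unfold prodExpect
  rw [← (Fin.consEquiv fun _ : Fin (M + 1) => ι).sum_comp, Fintype.sum_prod_type]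
  refine Finset.sum_congr rfl fun j _ => ?_
  rw [Finset.mul_sum]
  refine Finset.sum_congr rfl fun a _ => ?_
  simp [Fin.consEquiv, Fin.prod_univ_succ, Fin.tail, mul_assoc]

theorem prodExpect_mono {M : ℕ} {p : Fin M → ι → ℝ} (hp : ∀ i j, 0 ≤ p i j)
    {f g : (Fin M → ι) → ℝ} (h : ∀ a, f a ≤ g a) : prodExpect p f ≤ prodExpect p g :=
  Finset.sum_le_sum fun a _ =>
    mul_le_mul_of_nonneg_left (h a) (Finset.prod_nonneg fun i _ => hp i _)

theorem sum_mul_mul_le_of_disjoint_supports {q g₁ g₂ : ι → ℝ} (hq : ∀ j, 0 ≤ q j)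
    (hq1 : ∑ j, q j = 1) {α₁ α₂ : ℝ} (h₁ : ∀ j, α₁ ≤ g₁ j) (h₂ : ∀ j, α₂ ≤ g₂ j)
    (h : ∀ j, g₁ j = α₁ ∨ g₂ j = α₂) :
    ∑ j, q j * (g₁ j * g₂ j) ≤ (∑ j, q j * g₁ j) * ∑ j, q j * g₂ j := by
  have e : ∀ j, q j * (g₁ j * g₂ j) =
      α₁ * (q j * g₂ j) + α₂ * (q j * g₁ j) - α₁ * α₂ * q j := fun j => by
    rcases h j with h | h <;> rw [h] <;> ring
  have s₁ : 0 ≤ ∑ j, q j * g₁ j - α₁ := by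
    have : α₁ = ∑ j, q j * α₁ := by rw [← Finset.sum_mul, hq1, one_mul]
    rw [sub_nonneg]
    nth_rewrite 1 [this]
    exact Finset.sum_le_sum fun j _ => mul_le_mul_of_nonneg_left (h₁ j) (hq j)
  have s₂ : 0 ≤ ∑ j, q j * g₂ j - α₂ := by
    have : α₂ = ∑ j, q j * α₂ := by rw [← Finset.sum_mul, hq1, one_mul]
    rw [sub_nonneg]
    nth_rewrite 1 [this]
    exact Finset.sum_le_sum fun j _ => mul_le_mul_of_nonneg_left (h₂ j) (hq j)
  simp_rw [e, Finset.sum_sub_distrib, Finset.sum_add_distrib, ← Finset.mul_sum, hq1]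
  nlinarith [mul_nonneg s₁ s₂]

/-- Occupation numbers of independent variables are negatively associated. -/
theorem prodExpect_occupation_mul_le [DecidableEq ι] {I₁ I₂ : Finset ι} (hI : Disjoint I₁ I₂) {M : ℕ} :
    ∀ {p : Fin M → ι → ℝ}, (∀ i j, 0 ≤ p i j) → (∀ i, ∑ j, p i j = 1) →
    ∀ {φ₁ φ₂ : (ι → ℕ) → ℝ}, Monotone φ₁ → Monotone φ₂ →
      DependsOn φ₁ (I₁ : Set ι) → DependsOn φ₂ (I₂ : Set ι) →
      prodExpect p (fun a => φ₁ (occupation a) * φ₂ (occupation a)) ≤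
        prodExpect p (fun a => φ₁ (occupation a)) * prodExpect p fun a => φ₂ (occupation a) := by
  induction M with
  | zero => intro p _ _ φ₁ φ₂ _ _ _ _; simp [prodExpect]
  | succ M ih =>
    intro p hp hp1 φ₁ φ₂ m₁ m₂ d₁ d₂
    have shift_mono : ∀ {φ : (ι → ℕ) → ℝ}, Monotone φ → ∀ j,
        Monotone fun c => φ (c + Pi.single j 1) :=
      fun m j c c' h => m (by gcongr)
    have shift_dep : ∀ {φ : (ι → ℕ) → ℝ} {J : Finset ι}, DependsOn φ (J : Set ι) → ∀ j,
        DependsOn (fun c => φ (c + Pi.single j 1)) (J : Set ι) :=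
      fun dφ j c c' h => dφ fun i hi => by simp [h i hi]
    have shift_eq : ∀ {φ : (ι → ℕ) → ℝ} {J : Finset ι}, DependsOn φ (J : Set ι) → ∀ j ∉ J,
        ∀ c, φ (c + Pi.single j 1) = φ c :=
      fun dφ j hj c => dφ fun i hi => by
        have : i ≠ j := fun h => hj (h ▸ hi)
        simp [this]
    have le_shift : ∀ {φ : (ι → ℕ) → ℝ}, Monotone φ → ∀ j c, φ c ≤ φ (c + Pi.single j 1) :=
      fun m j c => m (le_add_of_nonneg_right (by simp))
    simp_rw [prodExpect_succ, occupation_cons]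
    have hp' : ∀ i j, 0 ≤ Fin.tail p i j := fun i j => hp _ _
    refine (Finset.sum_le_sum fun j _ => mul_le_mul_of_nonneg_left
      (ih hp' (fun i => hp1 _) (shift_mono m₁ j) (shift_mono m₂ j) (shift_dep d₁ j)
        (shift_dep d₂ j)) (hp 0 j)).trans ?_
    refine sum_mul_mul_le_of_disjoint_supports
      (α₁ := prodExpect (Fin.tail p) fun a => φ₁ (occupation a))
      (α₂ := prodExpect (Fin.tail p) fun a => φ₂ (occupation a)) (hp 0) (hp1 0)
      (fun j => prodExpect_mono hp' fun a => le_shift m₁ j _)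
      (fun j => prodExpect_mono hp' fun a => le_shift m₂ j _) fun j => ?_
    by_cases hj : j ∈ I₁
    · right
      simp_rw [shift_eq d₂ j (Finset.disjoint_left.1 hI hj)]
    · left
      simp_rw [shift_eq d₁ j hj]

/-- The expectation of a function of finitely many independent variables with values in a finite
set. -/
theorem integral_eq_prodExpect [MeasurableSpace ι] [MeasurableSingletonClass ι]
    {Ω : Type*} [MeasurableSpace Ω] {P : Measure Ω} [IsProbabilityMeasure P] {M : ℕ}
    {A : Fin M → Ω → ι} (hA : ∀ i, Measurable (A i)) (hind : iIndepFun A P)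
    (f : (Fin M → ι) → ℝ) :
    ∫ ω, f (fun i => A i ω) ∂P = prodExpect (fun i j => (P.map (A i)).real {j}) f := by
  have : ∀ i, IsProbabilityMeasure (P.map (A i)) :=
    fun i => Measure.isProbabilityMeasure_map (hA i).aemeasurable
  have hm : Measurable fun ω i => A i ω := measurable_pi_lambda _ hA
  have : IsProbabilityMeasure (P.map fun ω i => A i ω) :=
    Measure.isProbabilityMeasure_map hm.aemeasurable
  rw [← integral_map (φ := fun ω i => A i ω) hm.aemeasurable
    (measurable_of_countable f).aestronglyMeasurable, integral_fintype (.of_finite)]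
  unfold prodExpect
  refine Finset.sum_congr rfl fun a _ => ?_
  rw [(iIndepFun_iff_map_fun_eq_pi_map fun i => (hA i).aemeasurable).1 hind, smul_eq_mul,
    measureReal_def, ← Set.univ_pi_singleton, Measure.pi_pi, ENNReal.toReal_prod]
  rfl

theorem negativelyAssociated_occupation [DecidableEq ι] [MeasurableSpace ι]
    [MeasurableSingletonClass ι]
    {Ω : Type*} [MeasurableSpace Ω] {P : Measure Ω} [IsProbabilityMeasure P] {M : ℕ}
    {A : Fin M → Ω → ι} (hA : ∀ i, Measurable (A i)) (hind : iIndepFun A P) :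
    NegativelyAssociated P fun j ω => (occupation (fun i => A i ω) j : ℝ) := by
  intro I₁ I₂ hI φ₁ φ₂ m₁ m₂ _ _ _
  have : ∀ i, IsProbabilityMeasure (P.map (A i)) :=
    fun i => Measure.isProbabilityMeasure_map (hA i).aemeasurable
  have hm : Measurable fun ω i => A i ω := measurable_pi_lambda _ hA
  have memLp : ∀ f : (Fin M → ι) → ℝ, MemLp (fun ω => f fun i => A i ω) 2 P := fun f =>
    MemLp.of_bound ((measurable_of_countable f).comp hm).aestronglyMeasurable (∑ a, ‖f a‖)
      (ae_of_all _ fun ω => Finset.single_le_sum (f := fun a => ‖f a‖)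
        (fun a _ => norm_nonneg _) (Finset.mem_univ _))
  rw [covariance_eq_sub (memLp fun a => φ₁ fun i => (occupation a i : ℝ))
    (memLp fun a => φ₂ fun i => (occupation a i : ℝ)), sub_nonpos]
  have key := prodExpect_occupation_mul_le hI (p := fun i j => (P.map (A i)).real {j})
    (fun i j => measureReal_nonneg) (fun i => by simp)
    (φ₁ := fun c => φ₁ fun i : I₁ => (c i : ℝ)) (φ₂ := fun c => φ₂ fun i : I₂ => (c i : ℝ))
    (fun c c' h => m₁ fun i => Nat.cast_le.2 (h i))
    (fun c c' h => m₂ fun i => Nat.cast_le.2 (h i))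
    (fun c c' h => congrArg φ₁ (funext fun i => by rw [h i i.2]))
    (fun c c' h => congrArg φ₂ (funext fun i => by rw [h i i.2]))
  rw [← integral_eq_prodExpect hA hind, ← integral_eq_prodExpect hA hind,
    ← integral_eq_prodExpect hA hind] at key
  exact key

end OccupationNumbers

end Resampling

namespace Resampling

variable {d : ℕ} {X : Set (Fin d → ℝ)} {N : ℕ}

theorem WeightedSample.weight_nonneg (z : WeightedSample X N) (n : Fin N) : 0 ≤ z.weight n :=
  z.2.1 n

theorem WeightedSample.sum_weight (z : WeightedSample X N) : ∑ n, z.weight n = 1 := z.2.2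

theorem WeightedSample.cdf_mono (z : WeightedSample X N) : Monotone z.cdf := fun m n h =>
  Finset.sum_le_sum_of_subset_of_nonneg
    (fun k hk => by
      simp only [Finset.mem_filter, Finset.mem_univ, true_and] at hk ⊢
      exact hk.trans h)
    fun k _ _ => z.weight_nonneg k

theorem WeightedSample.cdf_nonneg (z : WeightedSample X N) (n : Fin N) : 0 ≤ z.cdf n :=
  Finset.sum_nonneg fun k _ => z.weight_nonneg k

theorem WeightedSample.cdf_le_one (z : WeightedSample X N) (n : Fin N) : z.cdf n ≤ 1 := by
  rw [← z.sum_weight]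
  exact Finset.sum_le_sum_of_subset_of_nonneg (Finset.filter_subset _ _)
    fun k _ _ => z.weight_nonneg k

theorem sum_filter_le_eq_add {f : Fin N → ℝ} (n : Fin N) :
    ∑ m ∈ Finset.univ.filter (fun m => m ≤ n), f m =
      f n + ∑ m ∈ Finset.univ.filter (fun m => m < n), f m := by
  rw [← Finset.sum_insert (by simp)]
  congr 1
  ext m
  simp [le_iff_eq_or_lt]

theorem WeightedSample.cdf_eq_add (z : WeightedSample X N) (n : Fin N) :
    z.cdf n = z.weight n + ∑ m ∈ Finset.univ.filter (fun m => m < n), z.weight m :=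
  sum_filter_le_eq_add n

theorem WeightedSample.cdf_le_cdf_sub_weight (z : WeightedSample X N) {m n : Fin N} (h : m < n) :
    z.cdf m ≤ z.cdf n - z.weight n := by
  rw [z.cdf_eq_add n, add_sub_cancel_left]
  exact Finset.sum_le_sum_of_subset_of_nonneg
    (fun k hk => by
      simp only [Finset.mem_filter, Finset.mem_univ, true_and] at hk ⊢
      exact hk.trans_lt h)
    fun k _ _ => z.weight_nonneg k

theorem WeightedSample.cdf_sub_weight_nonneg (z : WeightedSample X N) (n : Fin N) :
    0 ≤ z.cdf n - z.weight n := by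
  rw [z.cdf_eq_add n, add_sub_cancel_left]
  exact Finset.sum_nonneg fun k _ => z.weight_nonneg k

theorem WeightedSample.cdf_sub_weight_le (z : WeightedSample X N) {v : ℝ} (hv : 0 ≤ v) {n : Fin N}
    (h : ∀ m, m < n → z.cdf m < v) : z.cdf n - z.weight n ≤ v := by
  rw [z.cdf_eq_add n, add_sub_cancel_left]
  rcases Nat.eq_zero_or_pos n with h0 | h0
  · rw [Finset.filter_false_of_mem fun m _ => by rw [Fin.lt_def]; omega]
    simpa using hv
  · have hlt : (⟨n - 1, by omega⟩ : Fin N) < n := by rw [Fin.lt_def]; simp; omega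
    refine le_of_eq_of_le ?_ (h _ hlt).le
    unfold WeightedSample.cdf
    congr 1
    ext m
    simp only [Finset.mem_filter, Finset.mem_univ, true_and, Fin.lt_def, Fin.le_def]
    omega

theorem WeightedSample.quantile_le_iff (z : WeightedSample X N) {v : ℝ} (hv : v ≤ 1) {n : Fin N} :
    z.quantile v hv ≤ n ↔ v ≤ z.cdf n := by
  have h := (z.quantile_eq_iff v hv _).1 rfl
  refine ⟨fun hn => h.1.trans (z.cdf_mono hn), fun hn => ?_⟩
  by_contra! hlt
  exact absurd hn (h.2 n hlt).not_ge

theorem stratified_index_eq_iff (u : ℕ → I) (z : WeightedSample X N) (i n : Fin N) :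
    (stratified X).index N u z i = n ↔
      stratPoint u i ≤ z.cdf n ∧ ∀ m, m < n → z.cdf m < stratPoint u i :=
  z.quantile_eq_iff _ (stratPoint_le_one u i) _

theorem offspring_le (u : ℕ → I) (z : WeightedSample X N) (n : Fin N) :
    ((stratified X).offspring u z n : ℝ) ≤ N * z.weight n + 2 := by
  have hN : (0 : ℝ) < N := by exact_mod_cast Nat.pos_of_ne_zero z.size_ne_zero
  set a := z.cdf n - z.weight n with ha
  have hsub : (Finset.univ.filter fun i => (stratified X).index N u z i = n).image
      (fun i : Fin N => ((i : ℕ) : ℤ)) ⊆ Finset.Icc ⌈N * a - 1⌉ ⌊N * z.cdf n⌋ := by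
    intro k hk
    simp only [Finset.mem_image, Finset.mem_filter, Finset.mem_univ, true_and] at hk
    obtain ⟨i, hi, rfl⟩ := hk
    rw [stratified_index_eq_iff] at hi
    have h0 : 0 ≤ stratPoint u i := by
      have := (u i).2.1
      unfold stratPoint
      positivity
    have h1 := z.cdf_sub_weight_le h0 hi.2
    have h2 := hi.1
    unfold stratPoint at h1 h2
    rw [le_div_iff₀ hN] at h1
    rw [div_le_iff₀ hN] at h2
    have hu0 : (0 : ℝ) ≤ u i := (u i).2.1
    have hu1 : (u i : ℝ) ≤ 1 := (u i).2.2
    rw [Finset.mem_Icc, Int.ceil_le, Int.le_floor]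
    push_cast
    constructor <;> nlinarith
  have hcard := Finset.card_le_card hsub
  rw [Finset.card_image_of_injective _ fun i j h => Fin.ext (by simpa using h), Int.card_Icc]
    at hcard
  have hw : 0 ≤ (N : ℝ) * z.weight n := mul_nonneg hN.le (z.weight_nonneg n)
  have h1 : (((⌊N * z.cdf n⌋ + 1 - ⌈N * a - 1⌉).toNat : ℤ) : ℝ) ≤ N * z.weight n + 2 := by
    rw [Int.toNat_eq_max, Int.cast_max]
    refine max_le ?_ (by push_cast; linarith)
    push_cast
    have := Int.floor_le (N * z.cdf n)
    have := Int.le_ceil (N * a - 1)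
    have : N * a = N * z.cdf n - N * z.weight n := by rw [ha]; ring
    linarith
  refine le_trans ?_ h1
  exact_mod_cast hcard

theorem le_offspring (u : ℕ → I) (z : WeightedSample X N) (n : Fin N) :
    N * z.weight n - 2 ≤ ((stratified X).offspring u z n : ℝ) := by
  have hN : (0 : ℝ) < N := by exact_mod_cast Nat.pos_of_ne_zero z.size_ne_zero
  set a := z.cdf n - z.weight n with ha
  have hsub : Finset.Ioc ⌊N * a⌋ ⌊N * z.cdf n - 1⌋ ⊆
      (Finset.univ.filter fun i => (stratified X).index N u z i = n).image
        (fun i : Fin N => ((i : ℕ) : ℤ)) := by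
    intro k hk
    rw [Finset.mem_Ioc, Int.floor_lt, Int.le_floor] at hk
    have ha0 : 0 ≤ N * a := mul_nonneg hN.le (z.cdf_sub_weight_nonneg n)
    have hk0 : 0 ≤ k := by
      have : (0 : ℝ) < k := ha0.trans_lt hk.1
      exact_mod_cast this.le
    lift k to ℕ using hk0
    simp only [Int.cast_natCast] at hk
    have hkN : k < N := by
      have : (k : ℝ) < N := by nlinarith [z.cdf_le_one n]
      exact_mod_cast this
    simp only [Finset.mem_image, Finset.mem_filter, Finset.mem_univ, true_and]
    refine ⟨⟨k, hkN⟩, ?_, rfl⟩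
    have hu0 : (0 : ℝ) ≤ u k := (u k).2.1
    have hu1 : (u k : ℝ) ≤ 1 := (u k).2.2
    rw [stratified_index_eq_iff]
    unfold stratPoint
    refine ⟨?_, fun m hm => ?_⟩
    · rw [div_le_iff₀ hN]
      simp only
      linarith [hk.2]
    · rw [lt_div_iff₀ hN]
      have := mul_le_mul_of_nonneg_left (z.cdf_le_cdf_sub_weight hm) hN.le
      simp only
      linarith [hk.1]
  have hcard := Finset.card_le_card hsub
  rw [Finset.card_image_of_injective _ fun i j h => Fin.ext (by simpa using h), Int.card_Ioc]
    at hcard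
  have h1 : N * z.weight n - 2 ≤ (((⌊N * z.cdf n - 1⌋ - ⌊N * a⌋).toNat : ℤ) : ℝ) := by
    rw [Int.toNat_eq_max, Int.cast_max]
    refine le_max_of_le_left ?_
    push_cast
    have := Int.lt_floor_add_one (N * z.cdf n - 1)
    have := Int.floor_le (N * a)
    have : N * a = N * z.cdf n - N * z.weight n := by rw [ha]; ring
    linarith
  refine h1.trans ?_
  exact_mod_cast hcard

theorem abs_deviation_le_two (u : ℕ → I) (z : WeightedSample X N) (n : Fin N) :
    |(stratified X).deviation u z n| ≤ 2 := by
  unfold Scheme.deviation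
  rw [abs_le]
  constructor <;> linarith [offspring_le u z n, le_offspring u z n]

/-! ### The law of the resampled indices -/

theorem volume_real_coe_le (t : ℝ) :
    (volume : Measure I).real {u : I | (u : ℝ) ≤ t} = max (min 1 t) 0 := by
  have : Subtype.val '' {u : I | (u : ℝ) ≤ t} = Set.Icc 0 (min 1 t) := by
    ext x
    simp only [Set.mem_image, Set.mem_ofPred_eq, Subtype.exists, Set.mem_Icc, le_min_iff]
    constructor
    · rintro ⟨y, hy, h, rfl⟩
      exact ⟨hy.1, hy.2, h⟩
    · rintro ⟨h0, h1, h⟩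
      exact ⟨x, ⟨h0, h1⟩, h, rfl⟩
  rw [measureReal_def, unitInterval.volume_apply, this, Real.volume_Icc, sub_zero,
    ENNReal.toReal_ofReal']

theorem sum_clamp_sub_eq_min (N : ℕ) {t : ℝ} (ht : 0 ≤ t) :
    ∑ i ∈ Finset.range N, max (min 1 (t - i)) 0 = min t N := by
  induction N with
  | zero => simpa using ht
  | succ N ih =>
    rw [Finset.sum_range_succ, ih]
    push_cast
    grind

theorem eq_of_partial_sums_eq {f g : Fin N → ℝ}
    (h : ∀ n, ∑ m ∈ Finset.univ.filter (fun m => m ≤ n), f m =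
      ∑ m ∈ Finset.univ.filter (fun m => m ≤ n), g m) (n : Fin N) : f n = g n := by
  induction n using WellFoundedLT.induction with
  | _ n ih =>
    have hn := h n
    rw [sum_filter_le_eq_add, sum_filter_le_eq_add] at hn
    rw [Finset.sum_congr rfl fun m hm => ih m (Finset.mem_filter.1 hm).2] at hn
    exact add_right_cancel hn

section Law

variable {Ω : Type*} [MeasurableSpace Ω] {P : Measure Ω} {U : Ω → ℕ → I}

theorem measurable_stratified_index (hU : ∀ i, Measurable fun ω => U ω i)
    (z : WeightedSample X N) (i : Fin N) :
    Measurable fun ω => (stratified X).index N (U ω) z i :=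
  Measurable.comp (f := fun ω => (U ω, z)) ((stratified X).measurable_index N i)
    ((measurable_pi_lambda U hU).prodMk measurable_const)

theorem iIndepFun_stratified_index (hind : iIndepFun (fun i ω => U ω i) P)
    (z : WeightedSample X N) :
    iIndepFun (fun (i : Fin N) ω => (stratified X).index N (U ω) z i) P := by
  have hmeas : ∀ i : Fin N, Measurable fun v : I => (stratified X).index N (fun _ => v) z i :=
    fun i => measurable_stratified_index (fun _ => measurable_id) z i
  exact (hind.precomp Fin.val_injective).comp
    (fun i v => (stratified X).index N (fun _ => v) z i) hmeas

theorem measureReal_stratPoint_le (hU : ∀ i, Measurable fun ω => U ω i)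
    (hunif : ∀ i, P.map (fun ω => U ω i) = volume) (hN : N ≠ 0) (i : Fin N) (c : ℝ) :
    P.real {ω | stratPoint (U ω) i ≤ c} = max (min 1 (N * c - i)) 0 := by
  have hN : (0 : ℝ) < N := by exact_mod_cast Nat.pos_of_ne_zero hN
  rw [← volume_real_coe_le, ← hunif i, map_measureReal_apply (hU i)
    (measurableSet_le (by fun_prop) (by fun_prop))]
  congr 1
  ext ω
  simp only [stratPoint, Set.mem_ofPred_eq, Set.mem_preimage]
  rw [div_le_iff₀ hN]
  constructor <;> intro <;> linarith

variable [IsProbabilityMeasure P]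

/-- Stratified resampling is unbiased. -/
theorem sum_measureReal_stratified_index (hU : ∀ i, Measurable fun ω => U ω i)
    (hunif : ∀ i, P.map (fun ω => U ω i) = volume) (z : WeightedSample X N) (n : Fin N) :
    ∑ i, P.real {ω | (stratified X).index N (U ω) z i = n} = N * z.weight n := by
  refine eq_of_partial_sums_eq
    (f := fun n => ∑ i, P.real {ω | (stratified X).index N (U ω) z i = n})
    (g := fun n => N * z.weight n) (fun n => ?_) n
  rw [Finset.sum_comm, ← Finset.mul_sum]
  change _ = N * z.cdf n
  have hN : (0 : ℝ) ≤ N := Nat.cast_nonneg N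
  calc ∑ i : Fin N, ∑ m ∈ Finset.univ.filter (fun m => m ≤ n),
        P.real {ω | (stratified X).index N (U ω) z i = m}
      = ∑ i : Fin N, max (min 1 (N * z.cdf n - (i : ℕ))) 0 := by
        refine Finset.sum_congr rfl fun i _ => ?_
        rw [← measureReal_stratPoint_le hU hunif z.size_ne_zero, ← measureReal_biUnion_finset]
        · congr 1
          ext ω
          simp only [Finset.mem_filter, Finset.mem_univ, true_and, Set.mem_iUnion,
            Set.mem_ofPred_eq, exists_prop, exists_eq_right']
          exact z.quantile_le_iff (stratPoint_le_one (U ω) i)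
        · intro m _ m' _ hne
          exact Set.disjoint_left.2 fun ω h h' => hne (h.symm.trans h')
        · intro m _
          exact measurable_stratified_index hU z i (measurableSet_singleton m)
    _ = ∑ i ∈ Finset.range N, max (min 1 (N * z.cdf n - i)) 0 :=
        Fin.sum_univ_eq_sum_range (fun i : ℕ => max (min 1 (N * z.cdf n - i)) 0) N
    _ = N * z.cdf n := by
        rw [sum_clamp_sub_eq_min N (mul_nonneg hN (z.cdf_nonneg n)), min_eq_left]
        exact mul_le_of_le_one_right hN (z.cdf_le_one n)

theorem sum_integral_stratified_index (hU : ∀ i, Measurable fun ω => U ω i)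
    (hunif : ∀ i, P.map (fun ω => U ω i) = volume) (z : WeightedSample X N) (g : Fin N → ℝ) :
    ∑ i, ∫ ω, g ((stratified X).index N (U ω) z i) ∂P = N * ∑ n, z.weight n * g n := by
  have h : ∀ i, ∫ ω, g ((stratified X).index N (U ω) z i) ∂P =
      ∑ n, P.real {ω | (stratified X).index N (U ω) z i = n} * g n := fun i => by
    have hm := measurable_stratified_index (X := X) hU z i
    have : IsProbabilityMeasure (P.map fun ω => (stratified X).index N (U ω) z i) :=
      Measure.isProbabilityMeasure_map hm.aemeasurable
    rw [← integral_map (φ := fun ω => (stratified X).index N (U ω) z i) hm.aemeasurable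
      (measurable_of_countable g).aestronglyMeasurable, integral_fintype (.of_finite)]
    refine Finset.sum_congr rfl fun n _ => ?_
    rw [map_measureReal_apply hm (measurableSet_singleton n)]
    rfl
  simp_rw [h]
  rw [Finset.sum_comm, Finset.mul_sum]
  refine Finset.sum_congr rfl fun n _ => ?_
  rw [← Finset.sum_mul, sum_measureReal_stratified_index hU hunif z n, mul_assoc]

/-- Hoeffding's inequality for the lower tail of averages over the resampled points. -/
theorem measureReal_sum_stratified_index_le (hU : ∀ i, Measurable fun ω => U ω i)
    (hunif : ∀ i, P.map (fun ω => U ω i) = volume) (hind : iIndepFun (fun i ω => U ω i) P)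
    (z : WeightedSample X N) {g : Fin N → ℝ} (hg : ∀ n, g n ∈ Set.Icc (0 : ℝ) 1) {ε : ℝ}
    (hε : 0 ≤ ε) :
    P.real {ω | ∑ i, g ((stratified X).index N (U ω) z i) ≤
      N * (∑ n, z.weight n * g n - ε)} ≤ Real.exp (-(2 * ε ^ 2) * N) := by
  have hN : (0 : ℝ) < N := by exact_mod_cast Nat.pos_of_ne_zero z.size_ne_zero
  set Y : Fin N → Ω → ℝ := fun i ω => -g ((stratified X).index N (U ω) z i) with hY
  have hYm : ∀ i, Measurable (Y i) := fun i =>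
    ((measurable_of_countable g).comp (measurable_stratified_index hU z i)).neg
  have hsub : ∀ i ∈ Finset.univ, HasSubgaussianMGF (fun ω => Y i ω - P[Y i])
      ((‖(0 : ℝ) - (-1)‖₊ / 2) ^ 2) P := fun i _ =>
    hasSubgaussianMGF_of_mem_Icc (hYm i).aemeasurable (ae_of_all _ fun ω => by
      have := hg ((stratified X).index N (U ω) z i)
      simp only [hY, Set.mem_Icc] at this ⊢
      constructor <;> linarith)
  have hYind : iIndepFun (fun i ω => Y i ω - P[Y i]) P :=
    (iIndepFun_stratified_index hind z).comp (fun i n => -g n - ∫ ω, Y i ω ∂P)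
      fun i => measurable_of_countable _
  have h := HasSubgaussianMGF.measure_sum_ge_le_of_iIndepFun hYind hsub
    (ε := N * ε) (by positivity)
  have hmean : ∑ i, P[Y i] = -(N * ∑ n, z.weight n * g n) := by
    rw [← sum_integral_stratified_index hU hunif z g, ← Finset.sum_neg_distrib]
    exact Finset.sum_congr rfl fun i _ => integral_neg _
  convert h using 2
  · ext ω
    simp only [Set.mem_ofPred_eq]
    rw [Finset.sum_sub_distrib, hmean, hY, Finset.sum_neg_distrib]
    constructor <;> intro <;> linarith
  · simp
    field_simp

end Law

end Resampling

namespace Resampling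

/-- A second countable space has a countable family of open sets that approximates every open set
from inside, in measure. -/
theorem exists_countable_inner_approximation (E : Type*) [TopologicalSpace E]
    [SecondCountableTopology E] [MeasurableSpace E] :
    ∃ C : Set (Set E), C.Countable ∧ (∀ B ∈ C, IsOpen B) ∧
      ∀ (μ : Measure E) (G : Set E), IsOpen G → ∀ c < μ G, ∃ B ∈ C, B ⊆ G ∧ c < μ B := by
  obtain ⟨b, hbc, -, hb⟩ := TopologicalSpace.exists_countable_basis E
  refine ⟨Set.sUnion '' {S | S.Finite ∧ S ⊆ b}, (Set.countable_ofPred_finite_subset hbc).image _,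
    ?_, fun μ G hG c hc => ?_⟩
  · rintro _ ⟨S, hS, rfl⟩
    exact isOpen_sUnion fun s hs => hb.isOpen (hS.2 hs)
  · set T : Set (Set E) := {B ∈ Set.sUnion '' {S | S.Finite ∧ S ⊆ b} | B ⊆ G} with hT
    have hTc : T.Countable :=
      ((Set.countable_ofPred_finite_subset hbc).image _).mono (Set.sep_subset _ _)
    have hdir : DirectedOn (fun B B' : Set E => B ⊆ B') T := by
      rintro _ ⟨⟨S, hS, rfl⟩, hSG⟩ _ ⟨⟨S', hS', rfl⟩, hSG'⟩
      refine ⟨⋃₀ (S ∪ S'), ⟨⟨S ∪ S', ⟨hS.1.union hS'.1, Set.union_subset hS.2 hS'.2⟩, rfl⟩, ?_⟩,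
        ?_, ?_⟩
      · rw [Set.sUnion_union]
        exact Set.union_subset hSG hSG'
      · exact Set.sUnion_mono Set.subset_union_left
      · exact Set.sUnion_mono Set.subset_union_right
    have hG_eq : G = ⋃ B ∈ T, B := by
      refine Set.Subset.antisymm (fun x hx => ?_) (Set.iUnion₂_subset fun B hB => hB.2)
      obtain ⟨s, hs, hxs, hsG⟩ := hb.exists_subset_of_mem_open hx hG
      exact Set.mem_biUnion (x := s)
        ⟨⟨{s}, ⟨Set.finite_singleton s, Set.singleton_subset_iff.2 hs⟩, Set.sUnion_singleton s⟩,
          hsG⟩ hxs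
    rw [hG_eq, measure_biUnion_eq_iSup hTc hdir] at hc
    simp only [lt_iSup_iff] at hc
    obtain ⟨B, hB, hcB⟩ := hc
    exact ⟨B, hB.1, hB.2, hcB⟩

/-- If `νs` converges weakly to `μ` and `μs` asymptotically dominates `νs` on a family of open sets
that approximates all open sets, then `μs` converges weakly to `μ`. -/
theorem tendsto_of_eventually_sub_lt {E ι : Type*} [TopologicalSpace E] [MeasurableSpace E]
    [OpensMeasurableSpace E] [HasOuterApproxClosed E] {L : Filter ι} [L.IsCountablyGenerated]
    {μ : ProbabilityMeasure E} {μs νs : ι → ProbabilityMeasure E} (hν : Tendsto νs L (𝓝 μ))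
    {C : Set (Set E)} (hC : ∀ B ∈ C, IsOpen B)
    (happrox : ∀ G, IsOpen G → ∀ c < (μ : Measure E) G, ∃ B ∈ C, B ⊆ G ∧ c < (μ : Measure E) B)
    (h : ∀ B ∈ C, ∀ k : ℕ, ∀ᶠ i in L,
      (νs i : Measure E).real B - 1 / ((k : ℝ) + 1) < (μs i : Measure E).real B) :
    Tendsto μs L (𝓝 μ) := by
  refine tendsto_of_forall_isOpen_le_liminf' fun G hG => le_of_forall_lt fun c hc => ?_
  obtain ⟨c', hcc', hc'⟩ := exists_between hc
  obtain ⟨B, hBC, hBG, hB⟩ := happrox G hG c' hc'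
  have hlim := ProbabilityMeasure.le_liminf_measure_open_of_tendsto hν (hC B hBC)
  obtain ⟨c'', hc'c'', hc''⟩ := exists_between hB
  have hev : ∀ᶠ i in L, c'' < (νs i : Measure E) B :=
    eventually_lt_of_lt_liminf (hc''.trans_le hlim)
  have htop : c'' ≠ ∞ := hc''.ne_top
  have hpos : 0 < c''.toReal - c'.toReal :=
    sub_pos.2 ((ENNReal.toReal_lt_toReal hc'.ne_top htop).2 hc'c'')
  obtain ⟨k, hk⟩ := exists_nat_one_div_lt hpos
  refine hcc'.trans_le (le_liminf_of_le (by isBoundedDefault) ?_)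
  filter_upwards [hev, h B hBC k] with i h1 h2
  have h3 : c''.toReal < (νs i : Measure E).real B :=
    (ENNReal.toReal_lt_toReal htop (measure_ne_top _ _)).2 h1
  have h4 : c'.toReal < (μs i : Measure E).real B := by linarith
  exact ((ENNReal.toReal_lt_toReal hc'.ne_top (measure_ne_top _ _)).1 h4).le.trans
    (measure_mono hBG)

variable {d : ℕ} {X : Set (Fin d → ℝ)} {N : ℕ}

theorem WeightedSample.measure_real (z : WeightedSample X N) {B : Set X} (hB : MeasurableSet B) :
    (z.measure : Measure X).real B = ∑ n, z.weight n * B.indicator 1 (z.point n) := by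
  rw [measureReal_def]
  change ((∑ n, ENNReal.ofReal (z.weight n) • Measure.dirac (z.point n)) B).toReal = _
  rw [Measure.finsetSum_apply, ENNReal.toReal_sum]
  · refine Finset.sum_congr rfl fun n _ => ?_
    rw [Measure.smul_apply, Measure.dirac_apply' _ hB, smul_eq_mul, ENNReal.toReal_mul,
      ENNReal.toReal_ofReal (z.weight_nonneg n)]
    by_cases h : z.point n ∈ B <;> simp [h]
  · intro n _
    exact ENNReal.mul_ne_top ENNReal.ofReal_ne_top (measure_ne_top _ _)

theorem Scheme.resample_real (ρ : Scheme X) (u : ℕ → I) (z : WeightedSample X N) {B : Set X}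
    (hB : MeasurableSet B) :
    (ρ.resample u z : Measure X).real B =
      (N : ℝ)⁻¹ * ∑ i, B.indicator 1 (z.point (ρ.index N u z i)) := by
  rw [measureReal_def]
  change (((N : ℝ≥0∞)⁻¹ • ∑ n, Measure.dirac (z.point (ρ.index N u z n))) B).toReal = _
  rw [Measure.smul_apply, Measure.finsetSum_apply, smul_eq_mul, ENNReal.toReal_mul,
    ENNReal.toReal_sum]
  · congr 1
    · simp
    · refine Finset.sum_congr rfl fun n _ => ?_
      rw [Measure.dirac_apply' _ hB]
      by_cases h : z.point (ρ.index N u z n) ∈ B <;> simp [h]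
  · intro n _
    exact measure_ne_top _ _

/-- The event that the resampled measure gives much less mass to `B` than the weighted sample. -/
def massDefect (ρ : Scheme X) (N : ℕ) (B : Set X) (ε : ℝ) : Set ((ℕ → I) × WeightedSample X N) :=
  {p | (ρ.resample p.1 p.2 : Measure X).real B ≤ (p.2.measure : Measure X).real B - ε}

theorem measurableSet_massDefect (ρ : Scheme X) (N : ℕ) {B : Set X} (hB : MeasurableSet B)
    (ε : ℝ) : MeasurableSet (massDefect ρ N B ε) := by
  have hpt : ∀ n : Fin N, Measurable fun p : (ℕ → I) × WeightedSample X N => p.2.point n :=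
    fun n => by
      unfold WeightedSample.point
      fun_prop
  have hind : ∀ n : Fin N, Measurable fun p : (ℕ → I) × WeightedSample X N =>
      B.indicator (1 : X → ℝ) (p.2.point n) :=
    fun n => (measurable_one.indicator hB).comp (hpt n)
  have hw : ∀ n : Fin N, Measurable fun p : (ℕ → I) × WeightedSample X N => p.2.weight n :=
    fun n => by
      unfold WeightedSample.weight
      fun_prop
  have hsel : ∀ i : Fin N, Measurable fun p : (ℕ → I) × WeightedSample X N =>
      B.indicator (1 : X → ℝ) (p.2.point (ρ.index N p.1 p.2 i)) := fun i => by
    have hpair : Measurable fun q : ((ℕ → I) × WeightedSample X N) × Fin N =>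
        B.indicator (1 : X → ℝ) (q.1.2.point q.2) :=
      measurable_from_prod_countable_left hind
    exact hpair.comp (measurable_id.prodMk (ρ.measurable_index N i))
  unfold massDefect
  simp_rw [Scheme.resample_real ρ _ _ hB, WeightedSample.measure_real _ hB]
  exact measurableSet_le (measurable_const.mul (Finset.measurable_sum _ fun i _ => hsel i))
    ((Finset.measurable_sum _ fun n _ => (hw n).mul (hind n)).sub_const ε)

section Probability

variable {Ω : Type*} [MeasurableSpace Ω] {P : Measure Ω} [IsProbabilityMeasure P] {U : Ω → ℕ → I}

theorem measure_massDefect_le (hU : ∀ i, Measurable fun ω => U ω i)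
    (hunif : ∀ i, P.map (fun ω => U ω i) = volume) (hind : iIndepFun (fun i ω => U ω i) P)
    (z : WeightedSample X N) {B : Set X} (hB : MeasurableSet B) {ε : ℝ} (hε : 0 ≤ ε) :
    P {ω | (U ω, z) ∈ massDefect (stratified X) N B ε} ≤
      ENNReal.ofReal (Real.exp (-(2 * ε ^ 2) * N)) := by
  have hN : (0 : ℝ) < N := by exact_mod_cast Nat.pos_of_ne_zero z.size_ne_zero
  have h := measureReal_sum_stratified_index_le hU hunif hind z
    (g := fun n => B.indicator 1 (z.point n))
    (fun n => by by_cases h : z.point n ∈ B <;> simp [h]) hε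
  rw [← ofReal_measureReal]
  refine ENNReal.ofReal_le_ofReal (le_trans (le_of_eq ?_) h)
  congr 1
  ext ω
  simp only [massDefect, Set.mem_ofPred_eq, Scheme.resample_real _ _ _ hB, z.measure_real hB]
  rw [inv_mul_le_iff₀ hN]

theorem measure_random_massDefect_le (hU : ∀ i, Measurable fun ω => U ω i)
    (hunif : ∀ i, P.map (fun ω => U ω i) = volume) (hind : iIndepFun (fun i ω => U ω i) P)
    {ζ : Ω → WeightedSample X N} (hζ : Measurable ζ) (hUζ : IndepFun U ζ P)
    {B : Set X} (hB : MeasurableSet B) {ε : ℝ} (hε : 0 ≤ ε) :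
    P {ω | (U ω, ζ ω) ∈ massDefect (stratified X) N B ε} ≤
      ENNReal.ofReal (Real.exp (-(2 * ε ^ 2) * N)) := by
  have hUm : Measurable U := measurable_pi_lambda U hU
  have hmeas := measurableSet_massDefect (stratified X) N hB ε
  have : IsProbabilityMeasure (P.map U) := Measure.isProbabilityMeasure_map hUm.aemeasurable
  have : IsProbabilityMeasure (P.map ζ) := Measure.isProbabilityMeasure_map hζ.aemeasurable
  calc P {ω | (U ω, ζ ω) ∈ massDefect (stratified X) N B ε}
      = (P.map fun ω => (U ω, ζ ω)) (massDefect (stratified X) N B ε) :=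
        (Measure.map_apply (hUm.prodMk hζ) hmeas).symm
    _ = ((P.map U).prod (P.map ζ)) (massDefect (stratified X) N B ε) := by
        rw [(indepFun_iff_map_prod_eq_prod_map_map hUm.aemeasurable hζ.aemeasurable).1 hUζ]
    _ = ∫⁻ z, P.map U ((fun u => (u, z)) ⁻¹' massDefect (stratified X) N B ε) ∂(P.map ζ) :=
        Measure.prod_apply_symm hmeas
    _ ≤ ∫⁻ _, ENNReal.ofReal (Real.exp (-(2 * ε ^ 2) * N)) ∂(P.map ζ) := by
        refine lintegral_mono fun z => ?_
        rw [Measure.map_apply hUm (measurable_prodMk_right hmeas)]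
        exact measure_massDefect_le hU hunif hind z hB hε
    _ = ENNReal.ofReal (Real.exp (-(2 * ε ^ 2) * N)) := by simp

theorem ae_eventually_notMem_massDefect (hU : ∀ i, Measurable fun ω => U ω i)
    (hunif : ∀ i, P.map (fun ω => U ω i) = volume) (hind : iIndepFun (fun i ω => U ω i) P)
    {ζ : (N : ℕ+) → Ω → WeightedSample X N} (hζ : ∀ N, Measurable (ζ N))
    (hUζ : ∀ N, IndepFun U (ζ N) P) {B : Set X} (hB : MeasurableSet B) {ε : ℝ} (hε : 0 < ε) :
    ∀ᵐ ω ∂P, ∀ᶠ N : ℕ+ in atTop, (U ω, ζ N ω) ∉ massDefect (stratified X) N B ε := by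
  have hsum : Summable fun N : ℕ+ => Real.exp (-(2 * ε ^ 2) * (N : ℕ)) := by
    have h : Summable fun n : ℕ => Real.exp (n * -(2 * ε ^ 2)) :=
      Real.summable_exp_nat_mul_iff.2 (by nlinarith [sq_pos_of_pos hε])
    simp_rw [mul_comm _ (-(2 * ε ^ 2))] at h
    exact h.comp_injective PNat.coe_injective
  have hfin : ∑' N : ℕ+, P {ω | (U ω, ζ N ω) ∈ massDefect (stratified X) N B ε} ≠ ∞ :=
    ne_top_of_le_ne_top hsum.tsum_ofReal_ne_top
      (ENNReal.tsum_le_tsum fun N =>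
        measure_random_massDefect_le hU hunif hind (hζ N) (hUζ N) hB hε.le)
  filter_upwards [ae_finite_setOfPred_mem hfin] with ω hω
  exact atTop_le_cofinite hω.eventually_cofinite_notMem

theorem stratified_consistent (hU : ∀ i, Measurable fun ω => U ω i)
    (hunif : ∀ i, P.map (fun ω => U ω i) = volume) (hind : iIndepFun (fun i ω => U ω i) P)
    (P₀ : Set (ProbabilityMeasure X)) : (stratified X).Consistent P U P₀ := by
  intro π _ ζ hζ hUζ hlim
  obtain ⟨C, hCc, hCo, hC⟩ := exists_countable_inner_approximation X
  have hUζN : ∀ N, IndepFun U (ζ N) P := fun N =>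
    hUζ.comp measurable_id (measurable_pi_apply N)
  have hae : ∀ᵐ ω ∂P, ∀ B ∈ C, ∀ k : ℕ, ∀ᶠ N : ℕ+ in atTop,
      (U ω, ζ N ω) ∉ massDefect (stratified X) N B (1 / ((k : ℝ) + 1)) :=
    (ae_ball_iff hCc).2 fun B hB => ae_all_iff.2 fun k =>
      ae_eventually_notMem_massDefect hU hunif hind hζ hUζN (hCo B hB).measurableSet
        Nat.one_div_pos_of_nat
  filter_upwards [hlim, hae] with ω h1 h2
  exact tendsto_of_eventually_sub_lt h1 hCo (fun G hG c hc => hC _ G hG c hc) fun B hB k =>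
    (h2 B hB k).mono fun N hN => not_le.1 hN

theorem stratified_negativelyAssociated (hU : ∀ i, Measurable fun ω => U ω i)
    (hind : iIndepFun (fun i ω => U ω i) P) : (stratified X).H1 P U := fun _ z =>
  negativelyAssociated_occupation (measurable_stratified_index hU z)
    (iIndepFun_stratified_index hind z)

theorem stratified_deviations_negligible : (stratified X).H2 P U := by
  refine ⟨fun _ => 4, fun _ => by norm_num, ?_, Eventually.of_forall fun N => ?_, ?_⟩
  · refine isLittleO_const_left.2 (Or.inr ?_)
    have h : Tendsto (fun x : ℝ => x / Real.log x) atTop atTop := by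
      have h0 : Tendsto (fun x : ℝ => Real.log x / x) atTop (𝓝[>] 0) :=
        tendsto_nhdsWithin_iff.2 ⟨Real.isLittleO_log_id_atTop.tendsto_div_nhds_zero, by
          filter_upwards [eventually_gt_atTop 1] with x hx
          exact div_pos (Real.log_pos hx) (by linarith)⟩
      refine h0.inv_tendsto_nhdsGT_zero.congr fun x => ?_
      simp
    exact tendsto_norm_atTop_atTop.comp (h.comp tendsto_natCast_atTop_atTop)
  · refine iSup_le fun z => ?_
    calc ∑ n, ∫⁻ ω, ENNReal.ofReal ((stratified X).deviation (U ω) z n ^ 2) ∂P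
        ≤ ∑ _n : Fin N, ENNReal.ofReal 4 := by
          refine Finset.sum_le_sum fun n _ => ?_
          refine (lintegral_mono fun ω => ENNReal.ofReal_le_ofReal (q := 4) ?_).trans_eq (by simp)
          nlinarith [abs_le.1 (abs_deviation_le_two (U ω) z n)]
      _ = ENNReal.ofReal (4 * N) := by
          rw [Finset.sum_const, Finset.card_univ, Fintype.card_fin, nsmul_eq_mul, mul_comm,
            ENNReal.ofReal_mul (by norm_num), ENNReal.ofReal_natCast]
  · have h : ∀ N (z : WeightedSample X N),
        P {ω | ∃ n, 4 < |(stratified X).deviation (U ω) z n|} = 0 := fun N z => by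
      rw [show {ω | ∃ n, 4 < |(stratified X).deviation (U ω) z n|} = ∅ from
        Set.eq_empty_of_forall_notMem fun ω ⟨n, hn⟩ => by
          linarith [abs_deviation_le_two (U ω) z n], measure_empty]
    simp [h]

end Probability

end Resampling

theorem mainTheorem2 {d : ℕ} (X : Set (Fin d → ℝ)) (hX : Resampling.Cubifiable X)
    {Ω : Type*} [MeasurableSpace Ω] (P : Measure Ω) [IsProbabilityMeasure P]
    (U : Ω → ℕ → unitInterval)
    (hU_meas : ∀ i, Measurable fun ω => U ω i)
    (hU_unif : ∀ i, P.map (fun ω => U ω i) = volume)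
    (hU_indep : iIndepFun (fun i ω => U ω i) P) :
    (Resampling.stratified X).H1 P U ∧
    (Resampling.stratified X).H2 P U ∧
    (∀ (N : ℕ) (z : Resampling.WeightedSample X N), ∀ᵐ ω ∂P, ∀ n : Fin N,
      |(Resampling.stratified X).deviation (U ω) z n| ≤ 2) ∧
    (Resampling.stratified X).Consistent P U (Resampling.PbTilde X) := by
  exact ⟨Resampling.stratified_negativelyAssociated hU_meas hU_indep,
    Resampling.stratified_deviations_negligible,
    fun N z => ae_of_all P fun ω n => Resampling.abs_deviation_le_two (U ω) z n,
    Resampling.stratified_consistent hU_meas hU_unif hU_indep _⟩
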